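/- Let $n,m,n_c,\ell,\ell_u$ be positive integers. **Plant and constraints.** Consider $\dot x=f(x)+g(x)u$ with $f:\mathbb R^n\to\mathbb R^n$, $g:\mathbb R^n\to\mathbb R^{n\times m}$ locally Lipschitz. Let $h_1,\dots,h_\ell:\mathbb R^n\to\mathbb R$ and $\phi_1,\dots,\phi_{\ell_u}:\mathbb R^m\to\mathbb R$ be continuously differentiable, $S_s=\{x: h_j(x)\ge 0 \text{ for all } j\}$ (the safe set) and $U=\{u:\phi_\kappa(u)\ge 0\text{ for all }\kappa\}$ (the admissible inputs), with $\phi_\kappa'(u)\neq 0$ for all $u\in U$ and all $\kappa$. Let $Q$ and $c$ be locally Lipschitz on $\mathbb R^n$, with $Q(x)\in\mathbb R^{m\times m}$ symmetric positive definite and $c(x)\in\mathbb R^m$. For a map $\eta$ write $L_\psi\eta(x)=\eta'(x)\psi(x)$, and $L^i_\psi$ for the iterates if $\psi$ is a vector field. **Control dynamics.** The control is generated by $\dot x_c=f_c(x_c)+g_c(x_c)\hat u(x,x_c)$, $u=h_c(x_c)$, where $f_c:\mathbb R^{n_c}\to\mathbb R^{n_c}$, $g_c:\mathbb R^{n_c}\to\mathbb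 R^{n_c\times m}$, $h_c:\mathbb R^{n_c}\to\mathbb R^m$ are locally Lipschitz. Let $S_c=\{x_c:h_c(x_c)\in U\}$, $\hat x=(x,x_c)$, $\hat f(\hat x)=(f(x)+g(x)h_c(x_c),\,f_c(x_c))$ and $\hat g(\hat x)=\begin{bmatrix}0\\ g_c(x_c)\end{bmatrix}$. **Conditions.** There are positive integers $d_1,\dots,d_\ell,d_c,\zeta$ such that * (A1) for all $j$: $L_gL_f^ih_j(x)=0$ for all $x\in\mathbb R^n$ and $0\le i\le d_j-2$, and $L_gL_f^{d_j-1}h_j(x)\ne0$ for all $x\in S_s$; * (C1) for all $x_c\in\mathbb R^{n_c}$: $L_{g_c}L_{f_c}^ih_c(x_c)=0$ for $0\le i\le d_c-2$, and $L_{g_c}L_{f_c}^{d_c-1}h_c(x_c)$ is nonsingular; * (C2) for all $\kappa$: $L_{g_c}L_{f_c}^i(\phi_\kappa\circ h_c)(x_c)=0$ for all $x_c\in\mathbb R^{n_c}$ and $0\le i\le\zeta-2$, and $L_{g_c}L_{f_c}^{\zeta-1}(\phi_\kappa\circ h_c)(x_c)\neq0$ for all $x_c\in S_c$. **Composite soft-minimum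 R-CBF.** Let $\hat\ell=\ell+\ell_u$. For $1\le j\le\ell$ let $\hat h_j(\hat x)=h_j(x)$ and $\hat d_j=d_j+d_c$; for $\ell<j\le\hat\ell$ let $\hat h_j(\hat x)=\phi_{j-\ell}(h_c(x_c))$ and $\hat d_j=\zeta$. Let $\hat b_{j,0}=\hat h_j$ and $\hat b_{j,i+1}=L_{\hat f}\hat b_{j,i}+\hat\alpha_{j,i}(\hat b_{j,i})$ for $0\le i\le\hat d_j-2$, where each $\hat\alpha_{j,i}:\mathbb R\to\mathbb R$ is locally Lipschitz, strictly increasing and zero at $0$. Let $\hat C_{j,i}=\{\hat b_{j,i}\ge0\}$; let $\hat C_j=\hat C_{j,0}$ if $\hat d_j=1$ and $\hat C_j=\bigcap_{i=0}^{\hat d_j-2}\hat C_{j,i}$ if $\hat d_j>1$; let $\hat C=\bigcap_j\hat C_j$. For $\rho>0$ let $$\hat h(\hat x)=-\tfrac1\rho\log\sum_{j=1}^{\hat\ell}e^{-\rho\,\hat b_{j,\hat d_j-1}(\hat x)},\qquad \hat H=\{\hat h\ge0\},\qquad \hat S=\hat H\cap\hat C,\qquad \hat B=\{\hat x\in\partial\hat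 H: L_{\hat f}\hat h(\hat x)\le0\}.$$ **Surrogate control.** Let $u_d(\hat x)=-Q(x)^{-1}c(x)$, let $\sigma_0,\dots,\sigma_{d_c-1}>0$ be such that all roots of $s^{d_c}+\sigma_{d_c-1}s^{d_c-1}+\dots+\sigma_0$ have negative real part, and let $$\hat u_d(\hat x)=\big(L_{g_c}L_{f_c}^{d_c-1}h_c(x_c)\big)^{-1}\Big(L_{\hat f}^{d_c}u_d(\hat x)-L_{f_c}^{d_c}h_c(x_c)+\sum_{i=0}^{d_c-1}\sigma_i\big(L_{\hat f}^iu_d(\hat x)-L_{f_c}^ih_c(x_c)\big)\Big).$$ Let $\gamma>0$, let $\alpha:\mathbb R\to\mathbb R$ be locally Lipschitz and nondecreasing with $\alpha(0)=0$, and let $\hat\omega=L_{\hat f}\hat h+L_{\hat g}\hat h\,\hat u_d+\alpha(\hat h)$. The surrogate control is $$\hat u(\hat x)=\hat u_d(\hat x)+L_{\hat g}\hat h(\hat x)^{T}\hat\lambda(\hat x),\qquad \hat\lambda(\hat x)=\begin{cases}-\dfrac{\hat\omega(\hat x)}{L_{\hat g}\hat h(\hat x)L_{\hat g}\hat h(\hat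 x)^T+\gamma^{-1}\hat h(\hat x)^2},&\hat\omega(\hat x)<0,\\ 0,&\hat\omega(\hat x)\ge0.\end{cases}$$ **Smoothness convention.** All functions that are differentiated above are continuously differentiable: $L_f^ih_j$ ($i<d_j$), $L_{f_c}^ih_c$ ($i<d_c$), $L_{f_c}^i(\phi_\kappa\circ h_c)$ ($i<\zeta$), $L_{\hat f}^iu_d$ ($i<d_c$) and $\hat b_{j,i}$ ($i<\hat d_j$). **Claim.** Assume that $\hat h'$ is locally Lipschitz on $\hat S$ and that $L_{\hat g}\hat h(\hat x)\ne0$ for all $\hat x\in\hat B$. Let $\hat x_0\in\hat S$, let $0\le t_{\max}\le\infty$, and let $\hat x(t)=(x(t),x_c(t))$ be any solution of the closed loop $\dot{\hat x}=\hat f(\hat x)+\hat g(\hat x)\hat u(\hat x)$, $\hat x(0)=\hat x_0$, on $[0,t_{\max})$ (in particular the solution on its maximal interval of existence). Then for all $t\in[0,t_{\max})$: $\hat x(t)\in\hat S$, $x(t)\in S_s$, and $u(t)=h_c(x_c(t))\in U$. -/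

import Mathlib

noncomputable section

/-- Euclidean space of dimension `k`. -/
abbrev Euc (k : ℕ) : Type := EuclideanSpace ℝ (Fin k)

/-- The space of cascade states `x̂ = (x, x_c)`. -/
abbrev CascadeState (n nc : ℕ) : Type := Euc n × Euc nc

section LieDerivatives

variable {X V W : Type*} [NormedAddCommGroup X] [NormedSpace ℝ X]
  [NormedAddCommGroup V] [NormedSpace ℝ V] [NormedAddCommGroup W] [NormedSpace ℝ W]

/-- Lie derivative `L_ψ η (x) = η'(x) ψ(x)` along a vector field `ψ`.
The iterate `(lieD ψ)^[i] η` is `L_ψ^i η`. -/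
def lieD (ψ : X → X) (η : X → W) : X → W :=
  fun x => fderiv ℝ η x (ψ x)

/-- Lie derivative `L_ψ η (x) = η'(x) ψ(x)` along a matrix-valued map `ψ`, where the matrix `ψ x`
is the linear map `ψ x : V → X` and so `L_ψ η (x)` is the linear map `V → W`. -/
def lieDM (ψ : X → (V →L[ℝ] X)) (η : X → W) : X → (V →L[ℝ] W) :=
  fun x => (fderiv ℝ η x).comp (ψ x)

end LieDerivatives

/-- The transpose of a row vector, seen as a linear functional on `ℝᵐ`. -/
def rowTranspose {m : ℕ} (L : Euc m →L[ℝ] ℝ) : Euc m :=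
  (InnerProductSpace.toDual ℝ (Euc m)).symm L

/-- Log-sum-exponential soft minimum with parameter `ρ`. -/
def softmin {ι : Type*} [Fintype ι] (ρ : ℝ) (z : ι → ℝ) : ℝ :=
  -(1 / ρ) * Real.log (∑ i, Real.exp (-ρ * z i))

/-- Extended class-K functions: continuous, strictly increasing, vanishing at `0`. -/
def IsExtendedClassK (a : ℝ → ℝ) : Prop :=
  Continuous a ∧ StrictMono a ∧ a 0 = 0

/-- The time interval `[0, tmax)`, where `tmax` may be `+∞`. -/
def timeInterval (tmax : EReal) : Set ℝ :=
  {t | 0 ≤ t ∧ (t : EReal) < tmax}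

/-- `x` solves `ẋ = F(x)`, `x(0) = x₀` on `[0, tmax)` (with the right derivative at `0`). -/
def IsSolution {X : Type*} [NormedAddCommGroup X] [NormedSpace ℝ X]
    (F : X → X) (x₀ : X) (tmax : EReal) (x : ℝ → X) : Prop :=
  x 0 = x₀ ∧
    ∀ t ∈ timeInterval tmax, HasDerivWithinAt x (F (x t)) (timeInterval tmax) t

/-- The data: plant, cost, safety constraints, input constraints, control dynamics and the
user-selected parameters. No property is assumed here. -/
structure SafetyData (n m nc ℓ ℓu : ℕ) where
  /-- drift of the plant -/
  f : Euc n → Euc n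
  /-- input matrix of the plant -/
  g : Euc n → (Euc m →L[ℝ] Euc n)
  /-- safety constraint functions -/
  h : Fin ℓ → Euc n → ℝ
  /-- relative degrees of the safety constraint functions -/
  d : Fin ℓ → ℕ
  /-- quadratic part of the cost `J(x, u) = ½ uᵀ Q(x) u + c(x)ᵀ u` -/
  Q : Euc n → (Euc m →L[ℝ] Euc m)
  /-- linear part of the cost -/
  c : Euc n → Euc m
  /-- input constraint functions -/
  φ : Fin ℓu → Euc m → ℝ
  /-- drift of the control dynamics -/
  fc : Euc nc → Euc nc
  /-- input matrix of the control dynamics -/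
  gc : Euc nc → (Euc m →L[ℝ] Euc nc)
  /-- output map of the control dynamics -/
  hc : Euc nc → Euc m
  /-- relative degree of the control dynamics -/
  dc : ℕ
  /-- relative degree of the input constraint functions -/
  ζ : ℕ
  /-- the functions `α̂_{j,i}`, used for `i + 2 ≤ d̂_j` -/
  αHat : Fin ℓ ⊕ Fin ℓu → ℕ → ℝ → ℝ
  /-- soft-minimum parameter -/
  ρ : ℝ
  /-- slack weight -/
  γ : ℝ
  /-- the function `α` in the barrier constraint -/
  α : ℝ → ℝ
  /-- the gains `σ_i`, used for `i < d_c` -/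
  σ : ℕ → ℝ

namespace SafetyData

variable {n m nc ℓ ℓu : ℕ} (S : SafetyData n m nc ℓ ℓu)

/-- The safe set `S_s`. -/
def safeSet : Set (Euc n) :=
  {x | ∀ j, 0 ≤ S.h j x}

/-- The admissible input set `U`. -/
def inputSet : Set (Euc m) :=
  {u | ∀ κ, 0 ≤ S.φ κ u}

/-- The set `S_c` of controller states whose control is admissible. -/
def controllerSet : Set (Euc nc) :=
  {xc | S.hc xc ∈ S.inputSet}

/-- Condition A1: `h_j` has relative degree `d_j` on the safe set. -/
def CondA1 : Prop :=
  ∀ j, 0 < S.d j ∧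
    (∀ x, ∀ i, i + 2 ≤ S.d j → lieDM S.g ((lieD S.f)^[i] (S.h j)) x = 0) ∧
    (∀ x ∈ S.safeSet, lieDM S.g ((lieD S.f)^[S.d j - 1] (S.h j)) x ≠ 0)

/-- Condition C1: the control dynamics have relative degree `d_c` with nonsingular decoupling
matrix everywhere. -/
def CondC1 : Prop :=
  0 < S.dc ∧
    (∀ xc, ∀ i, i + 2 ≤ S.dc → lieDM S.gc ((lieD S.fc)^[i] S.hc) xc = 0) ∧
    (∀ xc, IsUnit (lieDM S.gc ((lieD S.fc)^[S.dc - 1] S.hc) xc))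

/-- Condition C2: every `φ_κ ∘ h_c` has relative degree `ζ` on `S_c`. -/
def CondC2 : Prop :=
  0 < S.ζ ∧
    (∀ κ xc, ∀ i, i + 2 ≤ S.ζ →
      lieDM S.gc ((lieD S.fc)^[i] (S.φ κ ∘ S.hc)) xc = 0) ∧
    (∀ κ, ∀ xc ∈ S.controllerSet,
      lieDM S.gc ((lieD S.fc)^[S.ζ - 1] (S.φ κ ∘ S.hc)) xc ≠ 0)

/-- Drift `f̂` of the cascade. -/
def fHat : CascadeState n nc → CascadeState n nc :=
  fun z => (S.f z.1 + S.g z.1 (S.hc z.2), S.fc z.2)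

/-- Input matrix `ĝ` of the cascade. -/
def gHat : CascadeState n nc → (Euc m →L[ℝ] CascadeState n nc) :=
  fun z => (0 : Euc m →L[ℝ] Euc n).prod (S.gc z.2)

/-- The constraint functions `ĥ_j` of the cascade; the index set `{1, …, ℓ + ℓ_u}` is
`Fin ℓ ⊕ Fin ℓu`. -/
def hHatJ : Fin ℓ ⊕ Fin ℓu → CascadeState n nc → ℝ
  | Sum.inl j => fun z => S.h j z.1
  | Sum.inr κ => fun z => S.φ κ (S.hc z.2)

/-- The relative degrees `d̂_j`. -/
def dHat : Fin ℓ ⊕ Fin ℓu → ℕ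
  | Sum.inl j => S.d j + S.dc
  | Sum.inr _ => S.ζ

/-- The functions `b̂_{j,i}`. -/
def bHat (j : Fin ℓ ⊕ Fin ℓu) : ℕ → CascadeState n nc → ℝ
  | 0 => S.hHatJ j
  | i + 1 => fun z => lieD S.fHat (bHat j i) z + S.αHat j i (bHat j i z)

/-- The sets `Ĉ_{j,i}`. -/
def CHatJI (j : Fin ℓ ⊕ Fin ℓu) (i : ℕ) : Set (CascadeState n nc) :=
  {z | 0 ≤ S.bHat j i z}

/-- The sets `Ĉ_j`. -/
def CHatJ (j : Fin ℓ ⊕ Fin ℓu) : Set (CascadeState n nc) :=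
  if S.dHat j = 1 then S.CHatJI j 0 else ⋂ i ∈ Finset.range (S.dHat j - 1), S.CHatJI j i

/-- The set `Ĉ`. -/
def CHat : Set (CascadeState n nc) :=
  ⋂ j, S.CHatJ j

/-- The composite soft-minimum function `ĥ`. -/
def hHat : CascadeState n nc → ℝ :=
  fun z => softmin S.ρ (fun j => S.bHat j (S.dHat j - 1) z)

/-- The zero-superlevel set `Ĥ` of `ĥ`. -/
def HHat : Set (CascadeState n nc) :=
  {z | 0 ≤ S.hHat z}

/-- The set `Ŝ = Ĥ ∩ Ĉ`. -/
def SHat : Set (CascadeState n nc) :=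
  S.HHat ∩ S.CHat

/-- The set `B̂`. -/
def BHat : Set (CascadeState n nc) :=
  {z | z ∈ frontier S.HHat ∧ lieD S.fHat S.hHat z ≤ 0}

/-- The desired control `u_d(x̂) = -Q(x)⁻¹ c(x)`. -/
def uD : CascadeState n nc → Euc m :=
  fun z => -((S.Q z.1).inverse (S.c z.1))

/-- The desired surrogate control. -/
def uHatD : CascadeState n nc → Euc m :=
  fun z => (lieDM S.gc ((lieD S.fc)^[S.dc - 1] S.hc) z.2).inverse
    ((lieD S.fHat)^[S.dc] S.uD z - (lieD S.fc)^[S.dc] S.hc z.2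
      + ∑ i ∈ Finset.range S.dc,
          S.σ i • ((lieD S.fHat)^[i] S.uD z - (lieD S.fc)^[i] S.hc z.2))

/-- `L_f̂ ĥ + L_ĝ ĥ û_d + α(ĥ)`; the set `Ω̂` is where it is negative. -/
def ωHat : CascadeState n nc → ℝ :=
  fun z => lieD S.fHat S.hHat z + lieDM S.gHat S.hHat z (S.uHatD z) + S.α (S.hHat z)

/-- The set `Ω̂`. -/
def ΩHat : Set (CascadeState n nc) :=
  {z | S.ωHat z < 0}

open scoped Classical in
/-- The multiplier `λ̂`. -/
def lamHat : CascadeState n nc → ℝ :=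
  fun z =>
    if z ∈ S.ΩHat then
      -(S.ωHat z / (lieDM S.gHat S.hHat z (rowTranspose (lieDM S.gHat S.hHat z))
        + S.γ⁻¹ * S.hHat z ^ 2))
    else 0

/-- The closed-form surrogate control `û = û_d + (L_ĝ ĥ)ᵀ λ̂`. -/
def uHat : CascadeState n nc → Euc m :=
  fun z => S.uHatD z + S.lamHat z • rowTranspose (lieDM S.gHat S.hHat z)

/-- The closed-loop vector field `f̂ + ĝ û`. -/
def closedLoop : CascadeState n nc → CascadeState n nc :=
  fun z => S.fHat z + S.gHat z (S.uHat z)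

/-- The standing assumptions on the data. -/
structure Standing : Prop where
  f_lip : LocallyLipschitz S.f
  g_lip : LocallyLipschitz S.g
  Q_lip : LocallyLipschitz S.Q
  c_lip : LocallyLipschitz S.c
  fc_lip : LocallyLipschitz S.fc
  gc_lip : LocallyLipschitz S.gc
  hc_lip : LocallyLipschitz S.hc
  h_C1 : ∀ j, ContDiff ℝ 1 (S.h j)
  φ_C1 : ∀ κ, ContDiff ℝ 1 (S.φ κ)
  φ_deriv_ne_zero : ∀ u ∈ S.inputSet, ∀ κ, fderiv ℝ (S.φ κ) u ≠ 0
  Q_symm : ∀ x u v, inner ℝ (S.Q x u) v = inner ℝ u (S.Q x v)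
  Q_pos : ∀ x u, u ≠ 0 → 0 < inner ℝ (S.Q x u) u
  αHat_classK : ∀ j i, i + 2 ≤ S.dHat j → IsExtendedClassK (S.αHat j i)
  αHat_lip : ∀ j i, i + 2 ≤ S.dHat j → LocallyLipschitz (S.αHat j i)
  ρ_pos : 0 < S.ρ
  γ_pos : 0 < S.γ
  α_lip : LocallyLipschitz S.α
  α_mono : Monotone S.α
  α_zero : S.α 0 = 0
  σ_pos : ∀ i < S.dc, 0 < S.σ i
  σ_hurwitz : ∀ s : ℂ,
    s ^ S.dc + ∑ i ∈ Finset.range S.dc, (S.σ i : ℂ) * s ^ i = 0 → s.re < 0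

/-- The smoothness convention: every function that is differentiated in a condition or in the
construction of the control is continuously differentiable. -/
structure Smooth : Prop where
  lie_h : ∀ j, ∀ i < S.d j, ContDiff ℝ 1 ((lieD S.f)^[i] (S.h j))
  lie_hc : ∀ i < S.dc, ContDiff ℝ 1 ((lieD S.fc)^[i] S.hc)
  lie_φ : ∀ κ, ∀ i < S.ζ, ContDiff ℝ 1 ((lieD S.fc)^[i] (S.φ κ ∘ S.hc))
  lie_uD : ∀ i < S.dc, ContDiff ℝ 1 ((lieD S.fHat)^[i] S.uD)
  bHat_C1 : ∀ j, ∀ i < S.dHat j, ContDiff ℝ 1 (S.bHat j i)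

end SafetyData

end

/-!
The function `b̂_{j,i}` is built with merely Lipschitz `α̂`, so its independence of the surrogate
control for `i ≤ d̂_j - 2` cannot be computed with iterated Lie derivatives of `ĥ_j`; it is read off
trajectories instead. Along an integral curve of `g_c(·) v` the functions `L_{f_c}^i h_c`,
`i ≤ d_c - 2`, are constant. Two trajectories of `f̂` issuing from the same plant state and from two
points of that curve therefore have controls that differ by `O(t ^ (d_c - 1))`, plant states that
differ by `O(t ^ d_c)` and constraint values that differ by `O(t ^ (d̂_j - 1))`. The chain
`b̂_{j,0}, b̂_{j,1}, …` along a trajectory consists of successive derivatives up to a Lipschitz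
perturbation, and a Taylor expansion shows that such an agreement of `b̂_{j,0}` forces the initial
values of `b̂_{j,i}`, `i ≤ d̂_j - 2`, to coincide. Hence `L_ĝ b̂_{j,i} = 0`.

Near a point of `Ĥ`, the closed loop satisfies `dĥ/dt ≥ ĥ` wherever `ĥ < 0`: either the barrier
constraint holds without correction or `L_ĝ ĥ` is bounded away from zero, which makes the slack
`γ⁻¹ ĥ²` harmless. So `ĥ` stays nonnegative, the soft minimum bounds every last function
`b̂_{j,d̂_j-1}` from below, and nonnegativity descends along each chain to `ĥ_j`.
-/

noncomputable section

open Filter Topology Asymptotics Set Metric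

open scoped Nat

section Asymptotics

variable {F : Type*} [NormedAddCommGroup F] [NormedSpace ℝ F]

theorem eventually_norm_le_pow_succ_of_hasDerivAt {e e' : ℝ → F} {k : ℕ} {C : ℝ} (hC : 0 ≤ C)
    (hd : ∀ᶠ t in 𝓝 0, HasDerivAt e (e' t) t) (h0 : e 0 = 0)
    (hb : ∀ᶠ t in 𝓝 0, ‖e' t‖ ≤ C * ‖t ^ k‖) :
    ∀ᶠ t in 𝓝 0, ‖e t‖ ≤ C * ‖t ^ (k + 1)‖ := by
  obtain ⟨ε, hε, hball⟩ := eventually_nhds_iff_ball.1 (hd.and hb)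
  filter_upwards [ball_mem_nhds (0 : ℝ) hε] with t ht
  have hsub : closedBall 0 ‖t‖ ⊆ ball (0 : ℝ) ε := closedBall_subset_ball (by simpa using ht)
  have hle : ‖e t - e 0‖ ≤ C * ‖t ^ k‖ * ‖t - 0‖ :=
    (convex_closedBall (0 : ℝ) ‖t‖).norm_image_sub_le_of_norm_hasDerivWithin_le
      (fun s hs => (hball s (hsub hs)).1.hasDerivWithinAt)
      (fun s hs => (hball s (hsub hs)).2.trans <| by
        rw [norm_pow, norm_pow]
        gcongr
        simpa using hs)
      (mem_closedBall_self (norm_nonneg t)) (by simp)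
  simpa [h0, pow_succ, mul_assoc] using hle

theorem isBigO_pow_succ_of_hasDerivAt {e e' : ℝ → F} {k : ℕ}
    (hd : ∀ᶠ t in 𝓝 0, HasDerivAt e (e' t) t) (h0 : e 0 = 0)
    (hb : e' =O[𝓝 0] fun t => t ^ k) : e =O[𝓝 0] fun t => t ^ (k + 1) := by
  obtain ⟨C, hC, hb⟩ := hb.exists_nonneg
  exact .of_bound C (eventually_norm_le_pow_succ_of_hasDerivAt hC hd h0 hb.bound)

theorem isLittleO_pow_succ_of_hasDerivAt {e e' : ℝ → F} {k : ℕ}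
    (hd : ∀ᶠ t in 𝓝 0, HasDerivAt e (e' t) t) (h0 : e 0 = 0)
    (hb : e' =o[𝓝 0] fun t => t ^ k) : e =o[𝓝 0] fun t => t ^ (k + 1) :=
  .of_bound fun _ hC => eventually_norm_le_pow_succ_of_hasDerivAt hC.le hd h0 (hb.bound hC)

theorem isBigO_pow_of_le {j k : ℕ} (hjk : j ≤ k) :
    (fun t : ℝ => t ^ k) =O[𝓝 0] fun t => t ^ j := by
  rcases hjk.eq_or_lt with rfl | hlt
  · exact isBigO_refl _ _
  · exact (isLittleO_pow_pow hlt).isBigO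

theorem isBigO_pow_succ_of_hasDerivAt_add {e p q : ℝ → F} {k : ℕ}
    (hd : ∀ᶠ t in 𝓝 0, HasDerivAt e (p t + q t) t) (h0 : e 0 = 0)
    (hp : p =O[𝓝 0] e) (hq : q =O[𝓝 0] fun t => t ^ k) :
    e =O[𝓝 0] fun t => t ^ (k + 1) := by
  suffices ∀ j ≤ k + 1, e =O[𝓝 0] fun t => t ^ j from this _ le_rfl
  intro j
  induction j with
  | zero =>
    simpa only [pow_zero] using fun _ => hd.self_of_nhds.continuousAt.tendsto.isBigO_one ℝ
  | succ j ih =>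
    exact fun hj => isBigO_pow_succ_of_hasDerivAt hd h0
      ((hp.trans (ih (by omega))).add (hq.trans (isBigO_pow_of_le (by omega))))

theorem isBigO_pow_add_of_successive_derivatives {M N : ℕ} (p : ℕ → ℝ → F)
    (hd : ∀ i < N, ∀ᶠ t in 𝓝 0, HasDerivAt (p i) (p (i + 1) t) t)
    (h0 : ∀ i < N, p i 0 = 0) (hN : p N =O[𝓝 0] fun t => t ^ M) :
    p 0 =O[𝓝 0] fun t => t ^ (M + N) := by
  induction N generalizing M with
  | zero => exact hN
  | succ N ih =>
    rw [← add_assoc, add_right_comm]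
    exact ih (fun i hi => hd i (by omega)) (fun i hi => h0 i (by omega))
      (isBigO_pow_succ_of_hasDerivAt (hd N (by omega)) (h0 N (by omega)) hN)

theorem hasDerivAt_pow_succ_div_factorial_smul (k : ℕ) (c : F) (t : ℝ) :
    HasDerivAt (fun t : ℝ => (t ^ (k + 1) / (k + 1)! : ℝ) • c) ((t ^ k / k ! : ℝ) • c) t := by
  refine (((hasDerivAt_pow (k + 1) t).div_const ((k + 1)! : ℝ)).smul_const c).congr_deriv ?_
  rw [Nat.factorial_succ, add_tsub_cancel_right]
  push_cast
  field_simp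

/-- Here `e (i + 1)` is the derivative of `e i` only up to an error `O(e i)`. Such an error does
not affect the leading term, since it is of higher order than `e (i + 1)` itself. -/
theorem isLittleO_taylor_of_perturbed_derivatives {N : ℕ} (e δ : ℕ → ℝ → F)
    (hc : ContinuousAt (e N) 0)
    (hd : ∀ i < N, ∀ᶠ t in 𝓝 0, HasDerivAt (e i) (δ i t) t)
    (hδ : ∀ i < N, (fun t => e (i + 1) t - δ i t) =O[𝓝 0] e i) (h0 : ∀ i < N, e i 0 = 0) :
    (fun t => e 0 t - (t ^ N / N ! : ℝ) • e N 0) =o[𝓝 0] fun t : ℝ => t ^ N := by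
  induction N generalizing e δ with
  | zero => simpa using hc.tendsto.sub_const (e 0 0)
  | succ N ih =>
    have h_e1 : (fun t => e 1 t - (t ^ N / N ! : ℝ) • e (N + 1) 0) =o[𝓝 0] fun t => t ^ N :=
      ih (fun i => e (i + 1)) (fun i => δ (i + 1)) hc (fun i hi => hd _ (by omega))
        (fun i hi => hδ _ (by omega)) (fun i hi => h0 _ (by omega))
    have h_lead : (fun t : ℝ => (t ^ N / N ! : ℝ) • e (N + 1) 0) =O[𝓝 0] fun t => t ^ N := by
      refine .of_bound (‖e (N + 1) 0‖ / N !) (.of_forall fun t => le_of_eq ?_)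
      rw [norm_smul, norm_div, RCLike.norm_natCast]
      ring
    have h_e1_O : e 1 =O[𝓝 0] fun t => t ^ N :=
      (h_e1.isBigO.add h_lead).congr_left fun t => sub_add_cancel _ _
    have h_e0 : e 0 =o[𝓝 0] fun t => t ^ N :=
      (isBigO_pow_succ_of_hasDerivAt_add
        ((hd 0 N.succ_pos).mono fun t ht => ht.congr_deriv (by simp))
        (h0 0 N.succ_pos) (hδ 0 N.succ_pos).neg_left h_e1_O).trans_isLittleO
        (isLittleO_pow_pow N.lt_succ_self)
    have h_δ0 : (fun t => δ 0 t - (t ^ N / N ! : ℝ) • e (N + 1) 0) =o[𝓝 0] fun t => t ^ N :=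
      (h_e1.sub ((hδ 0 N.succ_pos).trans_isLittleO h_e0)).congr_left fun t => by abel
    refine isLittleO_pow_succ_of_hasDerivAt ?_ (by simp [h0 0 N.succ_pos]) h_δ0
    exact (hd 0 N.succ_pos).mono fun t ht => ht.sub (hasDerivAt_pow_succ_div_factorial_smul _ _ t)

theorem eq_zero_of_isLittleO_pow_smul {k : ℕ} {c : F}
    (h : (fun t : ℝ => t ^ k • c) =o[𝓝 0] fun t => t ^ k) : c = 0 := by
  have hlim : Tendsto (fun _ : ℝ => c) (𝓝[≠] 0) (𝓝 0) := by
    refine (isLittleO_one_iff ℝ).1 (((isBigO_refl (fun t : ℝ => (t ^ k)⁻¹) (𝓝[≠] 0)).smul_isLittleO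
      (h.mono nhdsWithin_le_nhds)).congr' ?_ ?_) <;>
    · filter_upwards [self_mem_nhdsWithin] with t (ht : t ≠ 0)
      simp [ht]
  exact tendsto_nhds_unique tendsto_const_nhds hlim

theorem eq_zero_of_perturbed_derivatives {N : ℕ} (e δ : ℕ → ℝ → F)
    (hc : ∀ i ≤ N, ContinuousAt (e i) 0)
    (hd : ∀ i < N, ∀ᶠ t in 𝓝 0, HasDerivAt (e i) (δ i t) t)
    (hδ : ∀ i < N, e i 0 = 0 → (fun t => e (i + 1) t - δ i t) =O[𝓝 0] e i)
    (h0 : e 0 =o[𝓝 0] fun t => t ^ N) : ∀ i ≤ N, e i 0 = 0 := by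
  intro i
  induction i using Nat.strong_induction_on with
  | _ i ih =>
    intro hi
    have hz : ∀ j < i, e j 0 = 0 := fun j hj => ih j hj (by omega)
    have htaylor : (fun t => e 0 t - (t ^ i / i ! : ℝ) • e i 0) =o[𝓝 0] fun t => t ^ i :=
      isLittleO_taylor_of_perturbed_derivatives e δ (hc i hi) (fun j hj => hd j (by omega))
        (fun j hj => hδ j (by omega) (hz j hj)) hz
    have hlead : (fun t : ℝ => t ^ i • ((i ! : ℝ)⁻¹ • e i 0)) =o[𝓝 0] fun t => t ^ i :=
      ((h0.trans_isBigO (isBigO_pow_of_le hi)).sub htaylor).congr_left fun t => by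
        rw [sub_sub_cancel, smul_smul, div_eq_mul_inv]
    simpa [i.factorial_ne_zero] using eq_zero_of_isLittleO_pow_smul hlead

end Asymptotics

section ControlledTrajectories

variable {X V W : Type*} [NormedAddCommGroup X] [NormedAddCommGroup V] [NormedAddCommGroup W]

theorem isBigO_comp_sub_of_locallyLipschitz {ι : Type*} {l : Filter ι} {η : X → W}
    (hη : LocallyLipschitz η) {a b : ι → X} {x : X} (ha : Tendsto a l (𝓝 x))
    (hb : Tendsto b l (𝓝 x)) :
    (fun t => η (a t) - η (b t)) =O[l] fun t => a t - b t := by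
  obtain ⟨K, s, hs, hK⟩ := hη x
  refine .of_bound K ?_
  filter_upwards [ha hs, hb hs] with t hat hbt using hK.norm_sub_le hat hbt

variable [NormedSpace ℝ X] [NormedSpace ℝ V] [NormedSpace ℝ W]

theorem locallyLipschitz_clm_apply {Y : Type*} [PseudoEMetricSpace Y] {A : Y → V →L[ℝ] X}
    {u : Y → V} (hA : LocallyLipschitz A) (hu : LocallyLipschitz u) :
    LocallyLipschitz fun y => A y (u y) :=
  (isBoundedBilinearMap_apply (𝕜 := ℝ) (E := V) (F := X)).contDiff.locallyLipschitz.comp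
    (hA.prodMk hu)

theorem exists_eventually_hasDerivAt_of_locallyLipschitz [CompleteSpace X] {ψ : X → X}
    (hψ : LocallyLipschitz ψ) (x₀ : X) :
    ∃ γ : ℝ → X, γ 0 = x₀ ∧ ∀ᶠ t in 𝓝 0, HasDerivAt γ (ψ (γ t)) t := by
  obtain ⟨K, s, hs, hK⟩ := hψ x₀
  have hbdd : ∀ᶠ x in 𝓝 x₀, ‖ψ x‖ < ‖ψ x₀‖ + 1 :=
    hψ.continuous.norm.continuousAt.eventually_lt continuousAt_const (lt_add_one _)
  obtain ⟨r, hr, hball⟩ := nhds_basis_closedBall.mem_iff.1 (inter_mem hs hbdd)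
  set L : ℝ := ‖ψ x₀‖ + 1
  have hL : 0 < L := by positivity
  have hε : 0 < r / L := by positivity
  have hPL : IsPicardLindelof (fun _ => ψ) (tmin := -(r / L)) (tmax := r / L)
      ⟨0, by constructor <;> linarith⟩ x₀ ⟨r, hr.le⟩ 0 ⟨L, hL.le⟩ K :=
    .of_time_independent (fun x hx => (hball hx).2.le) (hK.mono fun x hx => (hball hx).1)
      (by simpa using! (mul_div_cancel₀ r hL.ne').le)
  obtain ⟨γ, hγ0, hγ⟩ := hPL.exists_eq_forall_mem_Icc_hasDerivWithinAt₀
  refine ⟨γ, hγ0, ?_⟩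
  filter_upwards [Ioo_mem_nhds (neg_lt_zero.2 hε) hε] with t ht
  exact (hγ t (Ioo_subset_Icc_self ht)).hasDerivAt (Icc_mem_nhds ht.1 ht.2)

theorem hasDerivAt_comp_curve {η : X → W} (hη : ContDiff ℝ 1 η) {a : ℝ → X} {v : X} {t : ℝ}
    (ha : HasDerivAt a v t) : HasDerivAt (fun s => η (a s)) (fderiv ℝ η (a t) v) t :=
  (hη.differentiable one_ne_zero (a t)).hasFDerivAt.comp_hasDerivAt t ha

theorem isBigO_state_sub_of_isBigO_input_sub {f : X → X} {g : X → V →L[ℝ] X}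
    (hf : LocallyLipschitz f) (hg : LocallyLipschitz g) {a b : ℝ → X} {u v : ℝ → V} {M : ℕ}
    (ha : ∀ᶠ t in 𝓝 0, HasDerivAt a (f (a t) + g (a t) (u t)) t)
    (hb : ∀ᶠ t in 𝓝 0, HasDerivAt b (f (b t) + g (b t) (v t)) t)
    (h0 : a 0 = b 0) (hu : ContinuousAt u 0)
    (huv : (fun t => u t - v t) =O[𝓝 0] fun t => t ^ M) :
    (fun t => a t - b t) =O[𝓝 0] fun t => t ^ (M + 1) := by
  have hca : Tendsto a (𝓝 0) (𝓝 (b 0)) := h0 ▸ ha.self_of_nhds.continuousAt.tendsto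
  have hcb : Tendsto b (𝓝 0) (𝓝 (b 0)) := hb.self_of_nhds.continuousAt
  have hdrift : (fun t => f (a t) - f (b t)) =O[𝓝 0] fun t => a t - b t :=
    isBigO_comp_sub_of_locallyLipschitz hf hca hcb
  have hgain : (fun t => (g (a t) - g (b t)) (u t)) =O[𝓝 0] fun t => a t - b t := by
    simpa using isBoundedBilinearMap_apply.isBigO_comp.trans
      ((isBigO_comp_sub_of_locallyLipschitz hg hca hcb).norm_norm.mul
        (hu.tendsto.isBigO_one ℝ).norm_left)
  have hinput : (fun t => g (b t) (u t - v t)) =O[𝓝 0] fun t => t ^ M := by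
    simpa using isBoundedBilinearMap_apply.isBigO_comp.trans
      (((hg.continuous.tendsto _).comp hcb).isBigO_one ℝ |>.norm_left.mul huv.norm_left)
  refine isBigO_pow_succ_of_hasDerivAt_add ?_ (sub_eq_zero.2 h0) (hdrift.add hgain) hinput
  filter_upwards [ha, hb] with t hat hbt
  refine (hat.sub hbt).congr_deriv ?_
  simp only [sub_apply, map_sub]
  abel

end ControlledTrajectories

section RelativeDegree

variable {X V W : Type*} [NormedAddCommGroup X] [NormedSpace ℝ X]
  [NormedAddCommGroup V] [NormedSpace ℝ V] [NormedAddCommGroup W] [NormedSpace ℝ W]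

/-- The output `η` of `ẋ = f(x) + g(x)u` has relative degree at least `r ≥ 1`: the input does not
enter the derivatives of the output of order less than `r`. The Lie derivatives that this involves
are required to be continuously differentiable. -/
structure RelDegreeGE (f : X → X) (g : X → V →L[ℝ] X) (η : X → W) (r : ℕ) : Prop where
  pos : 0 < r
  contDiff : ∀ i < r, ContDiff ℝ 1 ((lieD f)^[i] η)
  lieDM_eq_zero : ∀ i, i + 2 ≤ r → ∀ x, lieDM g ((lieD f)^[i] η) x = 0

namespace RelDegreeGE

variable {f : X → X} {g : X → V →L[ℝ] X} {η : X → W} {r : ℕ}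

theorem hasDerivAt_lie (h : RelDegreeGE f g η r) {i : ℕ} (hi : i + 2 ≤ r) {a : ℝ → X} {u : V}
    {t : ℝ} (ha : HasDerivAt a (f (a t) + g (a t) u) t) :
    HasDerivAt (fun s => (lieD f)^[i] η (a s)) ((lieD f)^[i + 1] η (a t)) t := by
  refine (hasDerivAt_comp_curve (h.contDiff i (by omega)) ha).congr_deriv ?_
  have hu : fderiv ℝ ((lieD f)^[i] η) (a t) (g (a t) u) = 0 :=
    DFunLike.congr_fun (h.lieDM_eq_zero i hi (a t)) u
  rw [map_add, hu, add_zero, Function.iterate_succ_apply', lieD]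

theorem isBigO_output_sub (h : RelDegreeGE f g η r) {a b : ℝ → X} {u v : ℝ → V} {M : ℕ}
    (ha : ∀ᶠ t in 𝓝 0, HasDerivAt a (f (a t) + g (a t) (u t)) t)
    (hb : ∀ᶠ t in 𝓝 0, HasDerivAt b (f (b t) + g (b t) (v t)) t)
    (h0 : ∀ i, i + 2 ≤ r → (lieD f)^[i] η (a 0) = (lieD f)^[i] η (b 0))
    (htop : (fun t => (lieD f)^[r - 1] η (a t) - (lieD f)^[r - 1] η (b t))
      =O[𝓝 0] fun t => t ^ M) :
    (fun t => η (a t) - η (b t)) =O[𝓝 0] fun t => t ^ (M + (r - 1)) := by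
  refine isBigO_pow_add_of_successive_derivatives
    (fun i t => (lieD f)^[i] η (a t) - (lieD f)^[i] η (b t)) (fun i hi => ?_)
    (fun i hi => sub_eq_zero.2 (h0 i (by omega))) htop
  filter_upwards [ha, hb] with t hat hbt
  exact (h.hasDerivAt_lie (by omega) hat).sub (h.hasDerivAt_lie (by omega) hbt)

theorem isBigO_autonomous_output_sub (h : RelDegreeGE f g η r) {a b : ℝ → X}
    (ha : ∀ᶠ t in 𝓝 0, HasDerivAt a (f (a t)) t) (hb : ∀ᶠ t in 𝓝 0, HasDerivAt b (f (b t)) t)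
    (h0 : ∀ i, i + 2 ≤ r → (lieD f)^[i] η (a 0) = (lieD f)^[i] η (b 0)) :
    (fun t => η (a t) - η (b t)) =O[𝓝 0] fun t => t ^ (r - 1) := by
  have hcont : Continuous ((lieD f)^[r - 1] η) :=
    (h.contDiff (r - 1) (Nat.sub_lt h.pos one_pos)).continuous
  have htop : ContinuousAt (fun t => (lieD f)^[r - 1] η (a t) - (lieD f)^[r - 1] η (b t)) 0 :=
    (hcont.continuousAt.comp ha.self_of_nhds.continuousAt).sub
      (hcont.continuousAt.comp hb.self_of_nhds.continuousAt)
  simpa using h.isBigO_output_sub (u := 0) (v := 0) (M := 0) (by simpa using ha)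
    (by simpa using hb) h0 (by simpa only [pow_zero] using htop.tendsto.isBigO_one ℝ)

theorem eventually_lie_eq_of_input_curve (h : RelDegreeGE f g η r) {a : ℝ → X} {v : V}
    (ha : ∀ᶠ t in 𝓝 0, HasDerivAt a (g (a t) v) t) :
    ∀ᶠ t in 𝓝 0, ∀ i, i + 2 ≤ r → (lieD f)^[i] η (a t) = (lieD f)^[i] η (a 0) := by
  obtain ⟨ε, hε, hball⟩ := eventually_nhds_iff_ball.1 ha
  filter_upwards [ball_mem_nhds 0 hε] with t ht i hi
  have hd : ∀ s ∈ ball 0 ε, HasDerivAt (fun s => (lieD f)^[i] η (a s)) 0 s := fun s hs =>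
    (hasDerivAt_comp_curve (h.contDiff i (by omega)) (hball s hs)).congr_deriv
      (DFunLike.congr_fun (h.lieDM_eq_zero i hi (a s)) v)
  exact isOpen_ball.is_const_of_deriv_eq_zero (convex_ball 0 ε).isPreconnected
    (fun s hs => (hd s hs).differentiableAt.differentiableWithinAt) (fun s hs => (hd s hs).deriv)
    ht (mem_ball_self hε)

end RelDegreeGE

end RelativeDegree

section Invariance

theorem nonneg_of_mul_le_deriv {y y' : ℝ → ℝ} {a b K : ℝ} (hab : a ≤ b)
    (hc : ContinuousOn y (Icc a b)) (hd : ∀ t ∈ Ioo a b, HasDerivAt y (y' t) t)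
    (hK : ∀ t ∈ Ioo a b, K * y t ≤ y' t) (ha : 0 ≤ y a) : 0 ≤ y b := by
  have hexp : ∀ t, HasDerivAt (fun t => Real.exp (-K * t)) (Real.exp (-K * t) * -K) t := fun t => by
    simpa using ((hasDerivAt_id t).const_mul (-K)).exp
  have hmono : MonotoneOn (fun t => y t * Real.exp (-K * t)) (Icc a b) := by
    refine monotoneOn_of_hasDerivWithinAt_nonneg
      (f' := fun t => y' t * Real.exp (-K * t) + y t * (Real.exp (-K * t) * -K))
      (convex_Icc a b) (hc.mul (by fun_prop)) ?_ ?_ <;> rw [interior_Icc] <;> intro t ht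
    · exact ((hd t ht).mul (hexp t)).hasDerivWithinAt
    · have := mul_nonneg (sub_nonneg.2 (hK t ht)) (Real.exp_pos (-K * t)).le
      linarith
  exact nonneg_of_mul_nonneg_left
    ((mul_nonneg ha (Real.exp_pos _).le).trans
      (hmono (left_mem_Icc.2 hab) (right_mem_Icc.2 hab) hab))
    (Real.exp_pos (-K * b))

theorem nonneg_of_forall_exists_mul_le_deriv {y y' : ℝ → ℝ} {a b : ℝ} (hab : a ≤ b)
    (hc : ContinuousOn y (Icc a b)) (hd : ∀ t ∈ Ioo a b, HasDerivAt y (y' t) t) (ha : 0 ≤ y a)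
    (hK : ∀ c ∈ Ico a b, 0 ≤ y c → ∃ K, ∀ᶠ t in 𝓝[>] c, y t < 0 → K * y t ≤ y' t) :
    0 ≤ y b := by
  have hclosed : IsClosed ({t | 0 ≤ y t} ∩ Icc a b) := by
    rw [inter_comm]
    exact hc.preimage_isClosed_of_isClosed isClosed_Icc isClosed_Ici
  refine hclosed.mem_of_ge_of_forall_exists_gt ha hab fun c ⟨hyc, hcab⟩ => ?_
  by_contra hempty
  have hneg : ∀ t ∈ Ioc c b, y t < 0 := fun t ht => not_le.1 fun hyt => hempty ⟨t, hyt, ht⟩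
  obtain ⟨K, hK⟩ := hK c hcab hyc
  obtain ⟨d, hd', hsub⟩ := (mem_nhdsGT_iff_exists_mem_Ioc_Ioo_subset hcab.2).1 hK
  refine (hneg d hd').not_ge (nonneg_of_mul_le_deriv (y' := y') hd'.1.le
    (hc.mono (Icc_subset_Icc hcab.1 hd'.2)) (fun t ht => ?_) (fun t ht => hsub ht ?_) hyc)
  · exact hd t ⟨hcab.1.trans_lt ht.1, ht.2.trans_le hd'.2⟩
  · exact hneg t ⟨ht.1, ht.2.le.trans hd'.2⟩

theorem Icc_zero_subset_timeInterval {tmax : EReal} {t : ℝ} (ht : t ∈ timeInterval tmax) :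
    Icc 0 t ⊆ timeInterval tmax :=
  fun _ hs => ⟨hs.1, (EReal.coe_le_coe_iff.2 hs.2).trans_lt ht.2⟩

variable {X : Type*} [NormedAddCommGroup X] [NormedSpace ℝ X]

theorem IsSolution.nonneg_comp {F : X → X} {x₀ : X} {tmax : EReal} {z : ℝ → X}
    (hz : IsSolution F x₀ tmax z) {η : X → ℝ} (hη : ContDiff ℝ 1 η) (h0 : 0 ≤ η x₀)
    (hK : ∀ s ∈ timeInterval tmax, 0 ≤ η (z s) →
      ∃ K, ∀ᶠ t in 𝓝[timeInterval tmax] s, η (z t) < 0 → K * η (z t) ≤ lieD F η (z t))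
    {t : ℝ} (ht : t ∈ timeInterval tmax) : 0 ≤ η (z t) := by
  have hsub : Icc 0 t ⊆ timeInterval tmax := Icc_zero_subset_timeInterval ht
  refine nonneg_of_forall_exists_mul_le_deriv (y := fun s => η (z s))
    (y' := fun s => lieD F η (z s)) ht.1 ?_ (fun s hs => ?_) (hz.1.symm ▸ h0) fun c hc hηc => ?_
  · exact hη.continuous.comp_continuousOn fun s hs =>
      (hz.2 s (hsub hs)).continuousWithinAt.mono hsub
  · exact hasDerivAt_comp_curve hη ((hz.2 s (hsub (Ioo_subset_Icc_self hs))).hasDerivAt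
      (mem_of_superset (Icc_mem_nhds hs.1 hs.2) hsub))
  · obtain ⟨K, hK⟩ := hK c (hsub (Ico_subset_Icc_self hc)) hηc
    refine ⟨K, Filter.Eventually.filter_mono (nhdsWithin_le_of_mem ?_) hK⟩
    exact mem_of_superset (Ioo_mem_nhdsGT hc.2)
      fun s hs => hsub ⟨hc.1.trans hs.1.le, hs.2.le⟩

end Invariance

section BarrierChain

variable {X : Type*} [NormedAddCommGroup X] [NormedSpace ℝ X]

/-- A higher-order barrier chain of the vector field `F`: each function is obtained from the
previous one by `b_{i+1} = L_F b_i + α_i(b_i)`. -/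
def IsBarrierChain (F : X → X) (α : ℕ → ℝ → ℝ) (b : ℕ → X → ℝ) : Prop :=
  ∀ i x, b (i + 1) x = lieD F (b i) x + α i (b i x)

namespace IsBarrierChain

variable {F : X → X} {α : ℕ → ℝ → ℝ} {b : ℕ → X → ℝ} {D : ℕ}

/-- The functions `α i` are only Lipschitz, so `b i` cannot be expressed through Lie derivatives
of `b 0`; along trajectories the terms `α i (b i)` are perturbations of the derivative. -/
theorem eq_of_isBigO_output_sub (hb : IsBarrierChain F α b)
    (hb1 : ∀ i < D, ContDiff ℝ 1 (b i)) (hα : ∀ i, i + 2 ≤ D → LocallyLipschitz (α i))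
    {z w : ℝ → X} (hz : ∀ᶠ t in 𝓝 0, HasDerivAt z (F (z t)) t)
    (hw : ∀ᶠ t in 𝓝 0, HasDerivAt w (F (w t)) t)
    (h0 : (fun t => b 0 (z t) - b 0 (w t)) =O[𝓝 0] fun t => t ^ (D - 1))
    {i : ℕ} (hi : i + 2 ≤ D) : b i (z 0) = b i (w 0) := by
  have hcz : ∀ k < D, ContinuousAt (fun t => b k (z t)) 0 := fun k hk =>
    (hb1 k hk).continuous.continuousAt.comp hz.self_of_nhds.continuousAt
  have hcw : ∀ k < D, ContinuousAt (fun t => b k (w t)) 0 := fun k hk =>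
    (hb1 k hk).continuous.continuousAt.comp hw.self_of_nhds.continuousAt
  refine sub_eq_zero.1 (eq_zero_of_perturbed_derivatives (N := D - 2)
    (fun k t => b k (z t) - b k (w t)) (fun k t => lieD F (b k) (z t) - lieD F (b k) (w t))
    (fun k hk => (hcz k (by omega)).sub (hcw k (by omega))) (fun k hk => ?_) (fun k hk hk0 => ?_)
    (h0.trans_isLittleO (isLittleO_pow_pow (by omega))) i (by omega))
  · filter_upwards [hz, hw] with t hzt hwt
    exact (hasDerivAt_comp_curve (hb1 k (by omega)) hzt).sub
      (hasDerivAt_comp_curve (hb1 k (by omega)) hwt)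
  · have hzw : b k (z 0) = b k (w 0) := sub_eq_zero.1 hk0
    refine (isBigO_comp_sub_of_locallyLipschitz (hα k (by omega)) (hcz k (by omega)).tendsto
      (hzw ▸ (hcw k (by omega)).tendsto)).congr_left fun t => ?_
    rw [hb, hb]
    ring

theorem nonneg_of_isSolution (hb : IsBarrierChain F α b)
    (hb1 : ∀ i, i + 2 ≤ D → ContDiff ℝ 1 (b i)) (hα : ∀ i, i + 2 ≤ D → ∀ y < 0, α i y ≤ 0)
    {Fcl : X → X} (hFcl : ∀ i, i + 2 ≤ D → ∀ x, lieD Fcl (b i) x = lieD F (b i) x)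
    {x₀ : X} {tmax : EReal} {z : ℝ → X} (hz : IsSolution Fcl x₀ tmax z)
    (h0 : ∀ i, i + 2 ≤ D → 0 ≤ b i x₀) (hlast : ∀ t ∈ timeInterval tmax, 0 ≤ b (D - 1) (z t))
    {i : ℕ} (hi : i < D) : ∀ t ∈ timeInterval tmax, 0 ≤ b i (z t) := by
  induction Nat.le_sub_one_of_lt hi using Nat.decreasingInduction with
  | self => exact hlast
  | of_succ i hi ih =>
    have hi2 : i + 2 ≤ D := by omega
    refine fun t => hz.nonneg_comp (hb1 i hi2) (h0 i hi2) fun s _ _ => ⟨0, ?_⟩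
    filter_upwards [self_mem_nhdsWithin] with r hr hneg
    have hnext : 0 ≤ lieD F (b i) (z r) + α i (b i (z r)) := hb i (z r) ▸ ih (by omega) r hr
    rw [zero_mul, hFcl i hi2]
    linarith [hα i hi2 _ hneg]

end IsBarrierChain

end BarrierChain

section Softmin

theorem softmin_le {ι : Type*} [Fintype ι] {ρ : ℝ} (hρ : 0 < ρ) (y : ι → ℝ) (i : ι) :
    softmin ρ y ≤ y i := by
  have hexp : Real.exp (-ρ * y i) ≤ ∑ i, Real.exp (-ρ * y i) :=
    Finset.single_le_sum (f := fun i => Real.exp (-ρ * y i)) (fun _ _ => (Real.exp_pos _).le)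
      (Finset.mem_univ i)
  have hlog : -ρ * y i ≤ Real.log (∑ i, Real.exp (-ρ * y i)) :=
    (Real.le_log_iff_exp_le ((Real.exp_pos _).trans_le hexp)).2 hexp
  calc softmin ρ y ≤ -(1 / ρ) * (-ρ * y i) :=
        mul_le_mul_of_nonpos_left hlog (neg_nonpos.2 (by positivity))
    _ = y i := by field_simp

theorem contDiff_softmin_comp {X ι : Type*} [NormedAddCommGroup X] [NormedSpace ℝ X] [Fintype ι]
    (ρ : ℝ) {k : WithTop ℕ∞} {b : ι → X → ℝ} (hb : ∀ i, ContDiff ℝ k (b i)) :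
    ContDiff ℝ k fun x => softmin ρ fun i => b i x := by
  rcases isEmpty_or_nonempty ι with hι | hι
  · simpa [softmin] using contDiff_const
  · exact contDiff_const.mul <| (ContDiff.sum fun i _ => (contDiff_const.mul (hb i)).exp).log
      fun x => (Finset.sum_pos (fun _ _ => Real.exp_pos _) Finset.univ_nonempty).ne'

end Softmin

section SafetyFilter

variable {X : Type*} [NormedAddCommGroup X] [NormedSpace ℝ X] {m : ℕ}

/-- The left-hand side `L_F η + L_G η k + α(η)` of the barrier constraint for the input affine
system `ẋ = F(x) + G(x)u` under the nominal control `k`. -/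
def barrierConstraint (F : X → X) (G : X → Euc m →L[ℝ] X) (η : X → ℝ) (α : ℝ → ℝ)
    (k : X → Euc m) (x : X) : ℝ :=
  lieD F η x + lieDM G η x (k x) + α (η x)

/-- The minimal-intervention control that corrects the nominal control `k` in the direction of
`L_G η` wherever the barrier constraint fails, with slack weight `γ`. The denominator vanishes
only if `η` and `L_G η` do, and then there is no correction. -/
def safetyFilter (F : X → X) (G : X → Euc m →L[ℝ] X) (η : X → ℝ) (α : ℝ → ℝ) (γ : ℝ)
    (k : X → Euc m) (x : X) : Euc m :=
  k x + (max (-barrierConstraint F G η α k x) 0 / (‖lieDM G η x‖ ^ 2 + γ⁻¹ * η x ^ 2)) •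
    rowTranspose (lieDM G η x)

theorem apply_rowTranspose_self (L : Euc m →L[ℝ] ℝ) : L (rowTranspose L) = ‖L‖ ^ 2 := by
  rw [rowTranspose, ← InnerProductSpace.toDual_symm_apply, real_inner_self_eq_norm_sq,
    LinearIsometryEquiv.norm_map]

variable {F : X → X} {G : X → Euc m →L[ℝ] X} {η : X → ℝ} {α : ℝ → ℝ} {γ : ℝ} {k : X → Euc m}

theorem le_lieD_safetyFilter (hγ : 0 < γ) {x : X} (hx : η x < 0) (hα : α (η x) ≤ 0)
    (hμ : max (-barrierConstraint F G η α k x) 0 * (γ⁻¹ * -η x) ≤ ‖lieDM G η x‖ ^ 2) :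
    η x ≤ lieD (fun y => F y + G y (safetyFilter F G η α γ k y)) η x := by
  have hlie : lieD (fun y => F y + G y (safetyFilter F G η α γ k y)) η x =
      barrierConstraint F G η α k x - α (η x) + max (-barrierConstraint F G η α k x) 0 /
        (‖lieDM G η x‖ ^ 2 + γ⁻¹ * η x ^ 2) * ‖lieDM G η x‖ ^ 2 := by
    have hω : barrierConstraint F G η α k x =
      fderiv ℝ η x (F x) + lieDM G η x (k x) + α (η x) := rfl
    have hG : ∀ v, fderiv ℝ η x (G x v) = lieDM G η x v := fun _ => rfl
    rw [lieD, map_add, hG, safetyFilter, map_add, map_smul, apply_rowTranspose_self, smul_eq_mul]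
    linarith
  have hμω := le_max_left (-barrierConstraint F G η α k x) 0
  have hμ0 := le_max_right (-barrierConstraint F G η α k x) 0
  generalize max (-barrierConstraint F G η α k x) 0 = μ at *
  generalize hN : ‖lieDM G η x‖ ^ 2 = N at *
  have hN0 : 0 ≤ N := hN ▸ sq_nonneg _
  have hq : 0 < γ⁻¹ * η x ^ 2 := mul_pos (inv_pos.2 hγ) (sq_pos_of_neg hx)
  have hNq : 0 < N + γ⁻¹ * η x ^ 2 := add_pos_of_nonneg_of_pos hN0 hq
  have hslack : μ * (γ⁻¹ * η x ^ 2) / (N + γ⁻¹ * η x ^ 2) ≤ -η x := by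
    rw [div_le_iff₀ hNq]
    calc μ * (γ⁻¹ * η x ^ 2) = -η x * (μ * (γ⁻¹ * -η x)) := by ring
      _ ≤ -η x * (N + γ⁻¹ * η x ^ 2) := by
        gcongr <;> linarith
  have hsplit : μ / (N + γ⁻¹ * η x ^ 2) * N = μ - μ * (γ⁻¹ * η x ^ 2) / (N + γ⁻¹ * η x ^ 2) := by
    rw [eq_sub_iff_add_eq, div_mul_eq_mul_div, ← add_div, ← mul_add,
      mul_div_cancel_right₀ _ hNq.ne']
  linarith

theorem eventually_le_lieD_safetyFilter (hF : Continuous F) (hG : Continuous G)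
    (hη : ContDiff ℝ 1 η) (hα : Continuous α) (hα0 : α 0 = 0) (hαneg : ∀ y < 0, α y ≤ 0)
    (hγ : 0 < γ) (hk : Continuous k)
    (hB : ∀ x ∈ frontier {x | 0 ≤ η x}, lieD F η x ≤ 0 → lieDM G η x ≠ 0)
    {x : X} (hx : 0 ≤ η x) :
    ∀ᶠ w in 𝓝 x, η w < 0 →
      η w ≤ lieD (fun y => F y + G y (safetyFilter F G η α γ k y)) η w := by
  by_cases hfr : x ∈ frontier {x | 0 ≤ η x}
  swap
  · have hint : x ∈ interior {x | 0 ≤ η x} := by_contra fun h => hfr ⟨subset_closure hx, h⟩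
    filter_upwards [mem_interior_iff_mem_nhds.1 hint] with w hw hneg using absurd hneg hw.not_gt
  have hx0 : η x = 0 := (frontier_le_subset_eq continuous_const hη.continuous hfr).symm
  have hη' := hη.continuous_fderiv one_ne_zero
  have hLG : Continuous (lieDM G η) := hη'.clm_comp hG
  have hω : Continuous (barrierConstraint F G η α k) :=
    ((hη'.clm_apply hF).add (hLG.clm_apply hk)).add (hα.comp hη.continuous)
  suffices ∀ᶠ w in 𝓝 x,
      max (-barrierConstraint F G η α k w) 0 * (γ⁻¹ * -η w) ≤ ‖lieDM G η w‖ ^ 2 from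
    this.mono fun w hμ hw => le_lieD_safetyFilter hγ hw (hαneg _ hw) hμ
  by_cases hL : lieDM G η x = 0
  · have hpos : 0 < barrierConstraint F G η α k x := by
      have hdrift : 0 < lieD F η x := not_le.1 fun hle => hB x hfr hle hL
      simpa [barrierConstraint, hL, hx0, hα0] using hdrift
    filter_upwards [continuousAt_const.eventually_lt hω.continuousAt hpos] with w hw
    rw [max_eq_right (by linarith), zero_mul]
    positivity
  · refine (ContinuousAt.eventually_lt ?_ (hLG.norm.pow 2).continuousAt ?_).mono fun w => le_of_lt
    · exact ((hω.neg.max continuous_const).mul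
        (continuous_const.mul hη.continuous.neg)).continuousAt
    · simpa [hx0] using pow_pos (norm_pos_iff.2 hL) 2

theorem IsSolution.nonneg_of_safetyFilter (hF : Continuous F) (hG : Continuous G)
    (hη : ContDiff ℝ 1 η) (hα : Continuous α) (hα0 : α 0 = 0) (hαneg : ∀ y < 0, α y ≤ 0)
    (hγ : 0 < γ) (hk : Continuous k)
    (hB : ∀ x ∈ frontier {x | 0 ≤ η x}, lieD F η x ≤ 0 → lieDM G η x ≠ 0)
    {x₀ : X} (hx₀ : 0 ≤ η x₀) {tmax : EReal} {z : ℝ → X}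
    (hz : IsSolution (fun x => F x + G x (safetyFilter F G η α γ k x)) x₀ tmax z) {t : ℝ}
    (ht : t ∈ timeInterval tmax) : 0 ≤ η (z t) := by
  refine hz.nonneg_comp hη hx₀ (fun s hs hηs => ⟨1, ?_⟩) ht
  simpa only [one_mul] using (hz.2 s hs).continuousWithinAt.eventually
    (eventually_le_lieD_safetyFilter hF hG hη hα hα0 hαneg hγ hk hB hηs)

end SafetyFilter

theorem continuous_iterate_lieD {X W : Type*} [NormedAddCommGroup X] [NormedSpace ℝ X]
    [NormedAddCommGroup W] [NormedSpace ℝ W] {ψ : X → X} {η : X → W} {r : ℕ} (hr : 0 < r)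
    (hψ : Continuous ψ) (hη : ∀ i < r, ContDiff ℝ 1 ((lieD ψ)^[i] η)) {i : ℕ} (hi : i ≤ r) :
    Continuous ((lieD ψ)^[i] η) := by
  rcases hi.lt_or_eq with hlt | rfl
  · exact (hη i hlt).continuous
  · obtain ⟨k, rfl⟩ := Nat.exists_eq_succ_of_ne_zero hr.ne'
    rw [Function.iterate_succ_apply']
    exact ((hη k k.lt_succ_self).continuous_fderiv one_ne_zero).clm_apply hψ

theorem continuous_clm_inverse {Y V : Type*} [TopologicalSpace Y] [NormedAddCommGroup V]
    [NormedSpace ℝ V] [CompleteSpace V] {A : Y → V →L[ℝ] V} (hA : Continuous A)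
    (hunit : ∀ y, IsUnit (A y)) : Continuous fun y => (A y).inverse := by
  refine continuous_iff_continuousAt.2 fun y => ?_
  simpa only [ContinuousLinearMap.ringInverse_eq_inverse] using!
    (NormedRing.inverse_continuousAt (hunit y).unit).comp (f := A) hA.continuousAt

theorem IsExtendedClassK.neg {a : ℝ → ℝ} (ha : IsExtendedClassK a) {y : ℝ} (hy : y < 0) :
    a y < 0 :=
  (ha.2.1 hy).trans_eq ha.2.2

namespace SafetyData

variable {n m nc ℓ ℓu : ℕ} {S : SafetyData n m nc ℓ ℓu}

section Cascade

theorem fHat_locallyLipschitz (hf : LocallyLipschitz S.f) (hg : LocallyLipschitz S.g)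
    (hfc : LocallyLipschitz S.fc) (hhc : LocallyLipschitz S.hc) : LocallyLipschitz S.fHat := by
  have hfst : LocallyLipschitz (Prod.fst : CascadeState n nc → Euc n) :=
    LipschitzWith.prod_fst.locallyLipschitz
  have hsnd : LocallyLipschitz (Prod.snd : CascadeState n nc → Euc nc) :=
    LipschitzWith.prod_snd.locallyLipschitz
  exact ((hf.comp hfst).add (locallyLipschitz_clm_apply (hg.comp hfst) (hhc.comp hsnd))).prodMk
    (hfc.comp hsnd)

theorem continuous_gHat (hgc : Continuous S.gc) : Continuous S.gHat :=
  (ContinuousLinearMap.prodₗᵢ ℝ).continuous.comp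
    (continuous_const.prodMk (hgc.comp continuous_snd))

theorem hasDerivAt_fst_of_fHat {z : ℝ → CascadeState n nc} {t : ℝ}
    (hz : HasDerivAt z (S.fHat (z t)) t) :
    HasDerivAt (fun s => (z s).1) (S.f (z t).1 + S.g (z t).1 (S.hc (z t).2)) t :=
  (ContinuousLinearMap.fst ℝ (Euc n) (Euc nc)).hasFDerivAt.comp_hasDerivAt t hz

theorem hasDerivAt_snd_of_fHat {z : ℝ → CascadeState n nc} {t : ℝ}
    (hz : HasDerivAt z (S.fHat (z t)) t) : HasDerivAt (fun s => (z s).2) (S.fc (z t).2) t :=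
  (ContinuousLinearMap.snd ℝ (Euc n) (Euc nc)).hasFDerivAt.comp_hasDerivAt t hz

end Cascade

variable (S) in
/-- The assumptions on the cascade under which the surrogate control does not enter the
derivatives of `b̂_{j,i}` for `i ≤ d̂_j - 2`. The decoupling matrices of the relative degrees may
be singular. -/
structure IsRegularCascade : Prop where
  f_lip : LocallyLipschitz S.f
  g_lip : LocallyLipschitz S.g
  fc_lip : LocallyLipschitz S.fc
  gc_lip : LocallyLipschitz S.gc
  h_relDegree : ∀ j, RelDegreeGE S.f S.g (S.h j) (S.d j)
  hc_relDegree : RelDegreeGE S.fc S.gc S.hc S.dc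
  φ_relDegree : ∀ κ, RelDegreeGE S.fc S.gc (S.φ κ ∘ S.hc) S.ζ
  bHat_C1 : ∀ j, ∀ i < S.dHat j, ContDiff ℝ 1 (S.bHat j i)
  αHat_lip : ∀ j i, i + 2 ≤ S.dHat j → LocallyLipschitz (S.αHat j i)

theorem isBarrierChain_bHat (j : Fin ℓ ⊕ Fin ℓu) :
    IsBarrierChain S.fHat (S.αHat j) (S.bHat j) := fun _ _ => rfl

namespace IsRegularCascade

theorem dHat_pos (hS : S.IsRegularCascade) : ∀ j, 0 < S.dHat j
  | .inl j => Nat.add_pos_left (hS.h_relDegree j).pos _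
  | .inr κ => (hS.φ_relDegree κ).pos

theorem fHat_lip (hS : S.IsRegularCascade) : LocallyLipschitz S.fHat :=
  fHat_locallyLipschitz hS.f_lip hS.g_lip hS.fc_lip
    (hS.hc_relDegree.contDiff 0 hS.hc_relDegree.pos).locallyLipschitz

theorem contDiff_hHat (hS : S.IsRegularCascade) : ContDiff ℝ 1 S.hHat :=
  contDiff_softmin_comp S.ρ fun j => hS.bHat_C1 j _ (Nat.sub_lt (hS.dHat_pos j) one_pos)

/-- The control, an output of relative degree `d_c` of the controller, differs by
`O(t ^ (d_c - 1))`, hence the plant state by `O(t ^ d_c)`, and `h_j` has relative degree `d_j`. -/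
theorem isBigO_plant_constraint_sub (hS : S.IsRegularCascade) (j : Fin ℓ)
    {z w : ℝ → CascadeState n nc} (hz : ∀ᶠ t in 𝓝 0, HasDerivAt z (S.fHat (z t)) t)
    (hw : ∀ᶠ t in 𝓝 0, HasDerivAt w (S.fHat (w t)) t) (hx : (z 0).1 = (w 0).1)
    (hxc : ∀ i, i + 2 ≤ S.dc →
      (lieD S.fc)^[i] S.hc (z 0).2 = (lieD S.fc)^[i] S.hc (w 0).2) :
    (fun t => S.h j (z t).1 - S.h j (w t).1) =O[𝓝 0] fun t => t ^ (S.d j + S.dc - 1) := by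
  have hz1 := hz.mono fun _ => hasDerivAt_fst_of_fHat
  have hw1 := hw.mono fun _ => hasDerivAt_fst_of_fHat
  have hcontrol : (fun t => S.hc (z t).2 - S.hc (w t).2) =O[𝓝 0] fun t => t ^ (S.dc - 1) :=
    hS.hc_relDegree.isBigO_autonomous_output_sub (hz.mono fun _ => hasDerivAt_snd_of_fHat)
      (hw.mono fun _ => hasDerivAt_snd_of_fHat) hxc
  have hcont : ContinuousAt (fun t => S.hc (z t).2) 0 :=
    (hS.hc_relDegree.contDiff 0 hS.hc_relDegree.pos).continuous.continuousAt.comp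
      hz.self_of_nhds.continuousAt.snd
  have hplant : (fun t => (z t).1 - (w t).1) =O[𝓝 0] fun t => t ^ (S.dc - 1 + 1) :=
    isBigO_state_sub_of_isBigO_input_sub hS.f_lip hS.g_lip hz1 hw1 hx hcont hcontrol
  have htop := isBigO_comp_sub_of_locallyLipschitz
    ((hS.h_relDegree j).contDiff (S.d j - 1)
      (Nat.sub_lt (hS.h_relDegree j).pos one_pos)).locallyLipschitz
    (hx ▸ hz1.self_of_nhds.continuousAt.tendsto) hw1.self_of_nhds.continuousAt.tendsto
  have hdj := (hS.h_relDegree j).pos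
  have hdc := hS.hc_relDegree.pos
  rw [show S.d j + S.dc - 1 = S.dc - 1 + 1 + (S.d j - 1) by omega]
  exact (hS.h_relDegree j).isBigO_output_sub hz1 hw1 (fun i _ => by rw [hx]) (htop.trans hplant)

theorem isBigO_input_constraint_sub (hS : S.IsRegularCascade) (κ : Fin ℓu)
    {z w : ℝ → CascadeState n nc} (hz : ∀ᶠ t in 𝓝 0, HasDerivAt z (S.fHat (z t)) t)
    (hw : ∀ᶠ t in 𝓝 0, HasDerivAt w (S.fHat (w t)) t)
    (hxc : ∀ i, i + 2 ≤ S.ζ →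
      (lieD S.fc)^[i] (S.φ κ ∘ S.hc) (z 0).2 = (lieD S.fc)^[i] (S.φ κ ∘ S.hc) (w 0).2) :
    (fun t => S.φ κ (S.hc (z t).2) - S.φ κ (S.hc (w t).2)) =O[𝓝 0] fun t => t ^ (S.ζ - 1) :=
  (hS.φ_relDegree κ).isBigO_autonomous_output_sub (hz.mono fun _ => hasDerivAt_snd_of_fHat)
    (hw.mono fun _ => hasDerivAt_snd_of_fHat) hxc

theorem eventually_bHat_eq_of_input_curve (hS : S.IsRegularCascade) (j : Fin ℓ ⊕ Fin ℓu) {i : ℕ}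
    (hi : i + 2 ≤ S.dHat j) (x : Euc n) {a : ℝ → Euc nc} {v : Euc m}
    (ha : ∀ᶠ s in 𝓝 0, HasDerivAt a (S.gc (a s) v) s) :
    ∀ᶠ s in 𝓝 0, S.bHat j i (x, a s) = S.bHat j i (x, a 0) := by
  have hchain {s : ℝ} (h : ∀ z w : ℝ → CascadeState n nc, z 0 = (x, a s) → w 0 = (x, a 0) →
      (∀ᶠ t in 𝓝 0, HasDerivAt z (S.fHat (z t)) t) →
      (∀ᶠ t in 𝓝 0, HasDerivAt w (S.fHat (w t)) t) →
      (fun t => S.hHatJ j (z t) - S.hHatJ j (w t)) =O[𝓝 0] fun t => t ^ (S.dHat j - 1)) :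
      S.bHat j i (x, a s) = S.bHat j i (x, a 0) := by
    obtain ⟨z, hz0, hz⟩ := exists_eventually_hasDerivAt_of_locallyLipschitz hS.fHat_lip (x, a s)
    obtain ⟨w, hw0, hw⟩ := exists_eventually_hasDerivAt_of_locallyLipschitz hS.fHat_lip (x, a 0)
    rw [← hz0, ← hw0]
    exact (isBarrierChain_bHat j).eq_of_isBigO_output_sub (hS.bHat_C1 j) (hS.αHat_lip j) hz hw
      (h z w hz0 hw0 hz hw) hi
  cases j with
  | inl j =>
    filter_upwards [hS.hc_relDegree.eventually_lie_eq_of_input_curve ha] with s hs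
    exact hchain fun z w hz0 hw0 hz hw => hS.isBigO_plant_constraint_sub j hz hw
      (by rw [hz0, hw0]) (by rwa [hz0, hw0])
  | inr κ =>
    filter_upwards [(hS.φ_relDegree κ).eventually_lie_eq_of_input_curve ha] with s hs
    exact hchain fun z w hz0 hw0 hz hw => hS.isBigO_input_constraint_sub κ hz hw
      (by rwa [hz0, hw0])

theorem lieDM_gHat_bHat_eq_zero (hS : S.IsRegularCascade) (j : Fin ℓ ⊕ Fin ℓu) {i : ℕ}
    (hi : i + 2 ≤ S.dHat j) (z : CascadeState n nc) : lieDM S.gHat (S.bHat j i) z = 0 := by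
  ext v
  obtain ⟨a, ha0, ha⟩ := exists_eventually_hasDerivAt_of_locallyLipschitz
    (locallyLipschitz_clm_apply hS.gc_lip (LocallyLipschitz.const v)) z.2
  have hcurve : HasDerivAt (fun s => ((z.1, a s) : CascadeState n nc)) (S.gHat (z.1, a 0) v) 0 :=
    (hasDerivAt_const _ _).prodMk ha.self_of_nhds
  have hderiv := hasDerivAt_comp_curve (hS.bHat_C1 j i (by omega)) hcurve
  have hconst : HasDerivAt (fun s => S.bHat j i (z.1, a s)) 0 0 :=
    (hasDerivAt_const _ _).congr_of_eventuallyEq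
      (hS.eventually_bHat_eq_of_input_curve j hi z.1 ha)
  simpa only [ha0] using! hderiv.unique hconst

end IsRegularCascade

theorem bHat_nonneg_of_mem_CHatJ {j : Fin ℓ ⊕ Fin ℓu} {z : CascadeState n nc}
    (hz : z ∈ S.CHatJ j) {i : ℕ} (hi : i + 2 ≤ S.dHat j) : 0 ≤ S.bHat j i z := by
  rw [CHatJ, if_neg (by omega)] at hz
  exact mem_iInter₂.1 hz i (Finset.mem_range.2 (by omega))

theorem mem_CHatJ_of_bHat_nonneg {j : Fin ℓ ⊕ Fin ℓu} {z : CascadeState n nc}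
    (hz : ∀ i < S.dHat j, 0 ≤ S.bHat j i z) : z ∈ S.CHatJ j := by
  rw [CHatJ]
  split_ifs with hd
  · exact hz 0 (by omega)
  · exact mem_iInter₂.2 fun i hi => hz i (by have := Finset.mem_range.1 hi; omega)

theorem uHat_eq_safetyFilter :
    S.uHat = safetyFilter S.fHat S.gHat S.hHat S.α S.γ S.uHatD := by
  funext z
  have hω : barrierConstraint S.fHat S.gHat S.hHat S.α S.uHatD z = S.ωHat z := rfl
  have hΩ : z ∈ S.ΩHat ↔ S.ωHat z < 0 := Iff.rfl
  rw [uHat, safetyFilter, lamHat, hω, apply_rowTranspose_self, hΩ]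
  split_ifs with hneg
  · rw [max_eq_left (by linarith), neg_div]
  · rw [max_eq_right (by linarith), zero_div]

theorem continuous_uHatD (hS : S.Standing) (hSm : S.Smooth) (hC1 : S.CondC1) :
    Continuous S.uHatD := by
  have hf : Continuous S.fHat :=
    (fHat_locallyLipschitz hS.f_lip hS.g_lip hS.fc_lip hS.hc_lip).continuous
  have huD {i : ℕ} (hi : i ≤ S.dc) : Continuous ((lieD S.fHat)^[i] S.uD) :=
    continuous_iterate_lieD hC1.1 hf hSm.lie_uD hi
  have hhc {i : ℕ} (hi : i ≤ S.dc) :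
      Continuous fun z : CascadeState n nc => (lieD S.fc)^[i] S.hc z.2 :=
    (continuous_iterate_lieD hC1.1 hS.fc_lip.continuous hSm.lie_hc hi).comp continuous_snd
  have hM : Continuous (lieDM S.gc ((lieD S.fc)^[S.dc - 1] S.hc)) :=
    ((hSm.lie_hc _ (Nat.sub_lt hC1.1 one_pos)).continuous_fderiv one_ne_zero).clm_comp
      hS.gc_lip.continuous
  refine ((continuous_clm_inverse hM hC1.2.2).comp continuous_snd).clm_apply
    (((huD le_rfl).sub (hhc le_rfl)).add (continuous_finsetSum _ fun i hi => ?_))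
  have hi' := (Finset.mem_range.1 hi).le
  exact ((huD hi').sub (hhc hi')).const_smul (S.σ i)

theorem Standing.isRegularCascade (hS : S.Standing) (hSm : S.Smooth) (hA1 : S.CondA1)
    (hC1 : S.CondC1) (hC2 : S.CondC2) : S.IsRegularCascade where
  f_lip := hS.f_lip
  g_lip := hS.g_lip
  fc_lip := hS.fc_lip
  gc_lip := hS.gc_lip
  h_relDegree j := ⟨(hA1 j).1, hSm.lie_h j, fun i hi x => (hA1 j).2.1 x i hi⟩
  hc_relDegree := ⟨hC1.1, hSm.lie_hc, fun i hi x => hC1.2.1 x i hi⟩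
  φ_relDegree κ := ⟨hC2.1, hSm.lie_φ κ, fun i hi x => hC2.2.1 κ x i hi⟩
  bHat_C1 := hSm.bHat_C1
  αHat_lip := hS.αHat_lip

end SafetyData

theorem mainTheorem1_general {n m nc ℓ ℓu : ℕ} (S : SafetyData n m nc ℓ ℓu)
    (hS : S.IsRegularCascade)
    (hαHat : ∀ j i, i + 2 ≤ S.dHat j → ∀ y < 0, S.αHat j i y ≤ 0)
    (hρ : 0 < S.ρ) (hγ : 0 < S.γ)
    (hα : Continuous S.α) (hα0 : S.α 0 = 0) (hαneg : ∀ y < 0, S.α y ≤ 0)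
    (hB : ∀ z ∈ S.BHat, lieDM S.gHat S.hHat z ≠ 0)
    (k : CascadeState n nc → Euc m) (hk : Continuous k)
    (z₀ : CascadeState n nc) (hz₀ : z₀ ∈ S.SHat)
    (tmax : EReal) (z : ℝ → CascadeState n nc)
    (hz : IsSolution
      (fun x => S.fHat x + S.gHat x (safetyFilter S.fHat S.gHat S.hHat S.α S.γ k x)) z₀ tmax z) :
    ∀ t ∈ timeInterval tmax,
      z t ∈ S.SHat ∧ (z t).1 ∈ S.safeSet ∧ S.hc (z t).2 ∈ S.inputSet := by
  have hhHat : ∀ t ∈ timeInterval tmax, 0 ≤ S.hHat (z t) := fun t ht =>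
    hz.nonneg_of_safetyFilter hS.fHat_lip.continuous
      (SafetyData.continuous_gHat hS.gc_lip.continuous) hS.contDiff_hHat hα hα0 hαneg hγ hk
      (fun x hx hle => hB x ⟨hx, hle⟩) hz₀.1 ht
  have hlie : ∀ j i, i + 2 ≤ S.dHat j → ∀ x,
      lieD (fun x => S.fHat x + S.gHat x (safetyFilter S.fHat S.gHat S.hHat S.α S.γ k x))
        (S.bHat j i) x = lieD S.fHat (S.bHat j i) x := fun j i hi x =>
    (map_add _ _ _).trans <| add_eq_left.2 <|
      DFunLike.congr_fun (hS.lieDM_gHat_bHat_eq_zero j hi x) _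
  have hbHat : ∀ j, ∀ i < S.dHat j, ∀ t ∈ timeInterval tmax, 0 ≤ S.bHat j i (z t) := fun j i hi =>
    (SafetyData.isBarrierChain_bHat j).nonneg_of_isSolution
      (fun i hi => hS.bHat_C1 j i (by omega)) (hαHat j) (hlie j) hz
      (fun i hi => SafetyData.bHat_nonneg_of_mem_CHatJ (mem_iInter.1 hz₀.2 j) hi)
      (fun t ht => (hhHat t ht).trans (softmin_le hρ _ j)) hi
  refine fun t ht => ⟨⟨hhHat t ht, mem_iInter.2 fun j =>
    SafetyData.mem_CHatJ_of_bHat_nonneg fun i hi => hbHat j i hi t ht⟩, fun j => ?_, fun κ => ?_⟩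
  · exact hbHat (.inl j) 0 (hS.dHat_pos _) t ht
  · exact hbHat (.inr κ) 0 (hS.dHat_pos _) t ht

theorem mainTheorem1 {n m nc ℓ ℓu : ℕ} (S : SafetyData n m nc ℓ ℓu)
    (hStanding : S.Standing) (hSmooth : S.Smooth)
    (hA1 : S.CondA1) (hC1 : S.CondC1) (hC2 : S.CondC2)
    (hLip : LocallyLipschitzOn S.SHat (fderiv ℝ S.hHat))
    (hB : ∀ z ∈ S.BHat, lieDM S.gHat S.hHat z ≠ 0)
    (z₀ : CascadeState n nc) (hz₀ : z₀ ∈ S.SHat)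
    (tmax : EReal) (z : ℝ → CascadeState n nc)
    (hz : IsSolution S.closedLoop z₀ tmax z) :
    ∀ t ∈ timeInterval tmax,
      z t ∈ S.SHat ∧ (z t).1 ∈ S.safeSet ∧ S.hc (z t).2 ∈ S.inputSet :=
  mainTheorem1_general S (hStanding.isRegularCascade hSmooth hA1 hC1 hC2)
    (fun j i hi _ hy => ((hStanding.αHat_classK j i hi).neg hy).le)
    hStanding.ρ_pos hStanding.γ_pos hStanding.α_lip.continuous hStanding.α_zero
    (fun _ hy => (hStanding.α_mono hy.le).trans_eq hStanding.α_zero) hB S.uHatD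
    (SafetyData.continuous_uHatD hStanding hSmooth hC1) z₀ hz₀ tmax z
    (SafetyData.uHat_eq_safetyFilter ▸ hz)

end
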